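/- Let $q,q'\in[0,1)$. Write $\mathbb N=\{0,1,\dots\}$. The deletion-insertion channel with deletion probability $q$ and insertion probability $q'$ takes an infinite bit string $\mathbf x=(x_0,x_1,\dots)\in\{0,1\}^{\mathbb N}$ as input and outputs a random string $\widetilde{\mathbf x}=(\widetilde x_0,\widetilde x_1,\dots)$ (the trace) as follows: first, for each $j\in\mathbb N$, insert $G_j-1$ independent uniform bits before the bit $x_j$, where the $G_j$ are independent with $\mathbb P[G_j=v]=(q')^{v-1}(1-q')$ for $v\in\{1,2,\dots\}$; then delete each bit of the resulting string independently with probability $q$. Let $\mathbb P_{\mathbf x}$ denote the law of the trace of $\mathbf x$, and let $\theta^s\mathbf x=(x_s,x_{s+1},\dots)$ be the shift of $\mathbf x$ by $s\in\mathbb N$. **Theorem 1.3.** There are positive constants $C_{\rm sep}$ and $C_{\rm fwd}$ depending only on $q$ and $q'$ such that the following holds. Let $d,m\in\mathbb N$ satisfy $d\le m^{2/3}$. Let $\mathbf x^{(1)},\mathbf x^{(2)}\in\{0,1\}^{\mathbb N}$ be such that $x^{(1)}_i=x^{(2)}_i$ for all $0\le i\le d$, but $x^{(1)}_i\neq x^{(2)}_i$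 for some $0\le i\le m$. Let $\sigma$ be a probability measure on $\{0,\dots,d\}$ with mean $\gamma=\sum_{s=0}^d\sigma(s)\,s$ satisfying $\sum_{s=0}^d\sigma(s)\,|s-\gamma|\le m^{1/3}$. For $i\in\{1,2\}$ and $j\in\mathbb N$ put $$q^{(i)}_{\sigma,j}:=\sum_{s=0}^d\sigma(s)\,\mathbb P_{\theta^s\mathbf x^{(i)}}[\widetilde x_j=1].$$ Then there is some $j\in\mathbb N$ with $j<C_{\rm fwd}\,m$ such that $$\bigl|q^{(1)}_{\sigma,j}-q^{(2)}_{\sigma,j}\bigr|\ \ge\ \exp\bigl(-C_{\rm sep}\,m^{1/3}\bigr).$$ -/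

import Mathlib

open MeasureTheory ProbabilityTheory

noncomputable section

/-- The randomness of the deletion-insertion channel, `ω = (N, B, D)`:
* `N j` is the number `G_j - 1` of bits inserted before the `j`th input bit;
* `B (j, i)` is the value of the `i`th bit (`i < N j`) inserted before the `j`th input bit;
* `D k = true` means that the bit in position `k` of the string obtained after the insertions
  is deleted. -/
abbrev ChannelSpace : Type := (ℕ → ℕ) × (ℕ × ℕ → Bool) × (ℕ → Bool)

/-- The law of the channel randomness with deletion probability `q` and insertion probability
`q'`: all coordinates are independent, `ℙ[G_j = v] = (q')^(v-1) (1-q')` for `v ≥ 1`, i.e.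
`ℙ[N j = n] = (q')^n (1-q')` for `n ≥ 0`, the inserted bits are uniform, and `ℙ[D k = true] = q`. -/
def channelMeasure (q q' : unitInterval) : Measure ChannelSpace :=
  (Measure.infinitePi fun _ : ℕ => geometricMeasure (unitInterval.symm q')).prod
    ((Measure.infinitePi fun _ : ℕ × ℕ => (PMF.uniformOfFintype Bool).toMeasure).prod
      (Measure.infinitePi fun _ : ℕ => bernoulliMeasure true false q))

/-- After the insertions the string is the concatenation of blocks: the `j`th block consists of the
`N j` bits inserted before the `j`th input bit, followed by the `j`th input bit.
`blockStart N j` is the position where the `j`th block starts. -/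
def blockStart (N : ℕ → ℕ) (j : ℕ) : ℕ := ∑ i ∈ Finset.range j, (N i + 1)

/-- The index of the block that contains position `k`: the greatest `j` with
`blockStart N j ≤ k` (such a `j` is at most `k`). -/
def blockIndex (N : ℕ → ℕ) (k : ℕ) : ℕ := Nat.findGreatest (fun j => blockStart N j ≤ k) k

/-- The string obtained from `x` after the insertions. -/
def insertedString (N : ℕ → ℕ) (B : ℕ × ℕ → Bool) (x : ℕ → Bool) (k : ℕ) : Bool :=
  if k - blockStart N (blockIndex N k) < N (blockIndex N k) then
    B (blockIndex N k, k - blockStart N (blockIndex N k))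
  else x (blockIndex N k)

/-- The trace of `x`: the bits of the string after insertions that are not deleted, in order.
Here `Nat.nth p j` is the position of the `j`th (counted from `0`) `k` with `p k`; almost surely
infinitely many bits are retained when `q < 1`. -/
def trace (ω : ChannelSpace) (x : ℕ → Bool) (j : ℕ) : Bool :=
  insertedString ω.1 ω.2.1 x (Nat.nth (fun k => ω.2.2 k = false) j)

/-- The probability that the `j`th bit of the trace of `x` equals `1`. -/
def traceBitProb (q q' : unitInterval) (x : ℕ → Bool) (j : ℕ) : ℝ :=
  (channelMeasure q q').real {ω | trace ω x j = true}

/-- The shift `θ^s` on infinite bit strings. -/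
def shift (s : ℕ) (x : ℕ → Bool) : ℕ → Bool := fun i => x (s + i)

/-- The mean of a probability measure on `{0, …, d}`. -/
def pmfMean {d : ℕ} (σ : PMF (Fin (d + 1))) : ℝ := ∑ s, (σ s).toReal * (s : ℝ)

/-- The expected absolute deviation from its mean of a probability measure on `{0, …, d}`. -/
def meanAbsDev {d : ℕ} (σ : PMF (Fin (d + 1))) : ℝ :=
  ∑ s, (σ s).toReal * |(s : ℝ) - pmfMean σ|

/-- The average over `s ∼ σ` of the probability that the `j`th bit of the trace of the shifted
string `θ^s x` equals `1`. -/
def shiftedTraceBitProb (q q' : unitInterval) {d : ℕ} (σ : PMF (Fin (d + 1))) (x : ℕ → Bool)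
    (j : ℕ) : ℝ :=
  ∑ s, (σ s).toReal * traceBitProb q q' (shift s x) j

end

/-! Run both strings through the same channel randomness. A trace bit depends on the input only when
it is a surviving input bit, so the difference of the `j`th bit probabilities is `∑ₖ bitDiff k ·
ℙ(hitEvent k j)` (`hasSum_traceBitProb_sub`). Taking generating functions in `w` turns this into an
explicit factor times `A(z) = ∑ₖ bitDiff k · z ^ k`, where `z` is a Möbius function of `w`
(`hasSum_pow_mul_traceBitProb_sub`). Since the strings agree up to `d`, a shift by `s` divides
`A(z)` by `z ^ s`; averaging over `σ` therefore only adds the factor `∑ σ(s) z ^ (d - s)`, up to `z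
^ d` (`pow_mul_tsum_avgDiff`).

Put `ε = m ^ (-1/3)` and look at points `z` with `‖1 - z‖ ≲ ε` and `1 - ‖z‖ ≍ ε²`. There the average
over `σ` has no serious cancellation. If `l ≤ m` is the first disagreement, then `‖z‖ ^ l ≥ exp(-C m
ε²)`, and a maximum principle argument on a short arc gives `‖A(z) / z ^ l‖ ≥ exp(-C / ε)` for some
such `z` (`exists_le_norm_realPowerSeries_on_arc`). Both exponents are of order `m ^ (1/3)`. The
corresponding `w` satisfies `‖w‖ ≤ 1 - c ε²` (`norm_blockPreimage_le`), so the terms with `j ≥ C m`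
are negligible and some earlier coefficient must be large (`exists_large_coeff`). -/

noncomputable section

/-! ### Positions of the input bits after the insertions -/

/-- The position of the `k`th input bit in the string obtained after the insertions. -/
def bitPos (N : ℕ → ℕ) (k : ℕ) : ℕ := blockStart N k + N k

lemma blockStart_succ (N : ℕ → ℕ) (k : ℕ) : blockStart N (k + 1) = bitPos N k + 1 := by
  simp [blockStart, bitPos, Finset.sum_range_succ, add_assoc]

lemma blockStart_strictMono (N : ℕ → ℕ) : StrictMono (blockStart N) :=
  strictMono_nat_of_lt_succ fun k => by rw [blockStart_succ, bitPos]; omega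

lemma bitPos_strictMono (N : ℕ → ℕ) : StrictMono (bitPos N) :=
  strictMono_nat_of_lt_succ fun k => by rw [bitPos, bitPos, blockStart_succ, bitPos]; omega

lemma blockIndex_eq {N : ℕ → ℕ} {k n : ℕ} (h : blockStart N k ≤ n) (h' : n < blockStart N (k + 1)) :
    blockIndex N n = k := by
  rw [blockIndex, Nat.findGreatest_eq_iff]
  refine ⟨((blockStart_strictMono N).le_apply).trans h, fun _ => h, fun j hj _ hle => ?_⟩
  have := (blockStart_strictMono N).monotone (show k + 1 ≤ j from hj)
  omega

lemma blockStart_blockIndex_le (N : ℕ → ℕ) (n : ℕ) : blockStart N (blockIndex N n) ≤ n :=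
  Nat.findGreatest_spec (P := fun j => blockStart N j ≤ n) (Nat.zero_le n) (by simp [blockStart])

lemma lt_blockStart_blockIndex_succ (N : ℕ → ℕ) (n : ℕ) :
    n < blockStart N (blockIndex N n + 1) := by
  by_contra! h
  have h1 : blockIndex N n + 1 ≤ n := ((blockStart_strictMono N).le_apply).trans h
  have := Nat.le_findGreatest (P := fun j => blockStart N j ≤ n) h1 h
  rw [← blockIndex] at this
  omega

lemma insertedString_bitPos (N : ℕ → ℕ) (B : ℕ × ℕ → Bool) (x : ℕ → Bool) (k : ℕ) :
    insertedString N B x (bitPos N k) = x k := by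
  have h : blockIndex N (bitPos N k) = k :=
    blockIndex_eq (by simp [bitPos]) (by rw [blockStart_succ]; omega)
  rw [insertedString, h]
  simp [bitPos]

lemma insertedString_congr_of_ne_bitPos {N : ℕ → ℕ} (B : ℕ × ℕ → Bool) (x y : ℕ → Bool) {n : ℕ}
    (h : ∀ k, bitPos N k ≠ n) : insertedString N B x n = insertedString N B y n := by
  have h1 := blockStart_blockIndex_le N n
  have h2 := lt_blockStart_blockIndex_succ N n
  have h3 := h (blockIndex N n)
  rw [blockStart_succ] at h2
  unfold bitPos at h2 h3
  have h4 : n - blockStart N (blockIndex N n) < N (blockIndex N n) := by omega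
  simp [insertedString, h4]

/-! ### The event that an input bit is retained at a given position of the trace -/

/-- The number of retained bits among the first `n` bits of the string after insertions. -/
def retainedBefore (D : ℕ → Bool) (n : ℕ) : ℕ := Nat.count (fun i => D i = false) n

/-- The event that the `k`th input bit is retained and becomes the `j`th bit of the trace. -/
def hitEvent (k j : ℕ) : Set ChannelSpace :=
  {ω | ω.2.2 (bitPos ω.1 k) = false ∧ retainedBefore ω.2.2 (bitPos ω.1 k) = j}

lemma trace_eq_of_mem_hitEvent {ω : ChannelSpace} {k j : ℕ} (h : ω ∈ hitEvent k j)
    (x : ℕ → Bool) : trace ω x j = x k := by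
  have : Nat.nth (fun i => ω.2.2 i = false) j = bitPos ω.1 k := by
    rw [← h.2]; exact Nat.nth_count h.1
  rw [trace, this, insertedString_bitPos]

/-- Infinitely many retained bits ensure that `Nat.nth` is not its default value. Off the hit
events, the position it returns carries an inserted bit, which does not see the input. -/
lemma trace_congr_of_notMem_hitEvent {ω : ChannelSpace} {j : ℕ}
    (hinf : {i | ω.2.2 i = false}.Infinite) (h : ∀ k, ω ∉ hitEvent k j) (x y : ℕ → Bool) :
    trace ω x j = trace ω y j := by
  refine insertedString_congr_of_ne_bitPos _ _ _ fun k hk => h k ⟨?_, ?_⟩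
  · rw [hk]; exact Nat.nth_mem_of_infinite (p := fun i => ω.2.2 i = false) hinf j
  · rw [hk]; exact Nat.count_nth_of_infinite (p := fun i => ω.2.2 i = false) hinf j

lemma pairwise_disjoint_hitEvent_left (j : ℕ) :
    Pairwise (Function.onFun Disjoint fun k => hitEvent k j) := by
  intro k l hkl
  refine Set.disjoint_left.2 fun ω hk hl => hkl ?_
  refine (bitPos_strictMono ω.1).injective ?_
  rw [← Nat.nth_count (p := fun i => ω.2.2 i = false) hk.1,
    ← Nat.nth_count (p := fun i => ω.2.2 i = false) hl.1]
  congr 1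
  exact hk.2.trans hl.2.symm

lemma pairwise_disjoint_hitEvent_right (k : ℕ) :
    Pairwise (Function.onFun Disjoint fun j => hitEvent k j) :=
  fun _ _ hij => Set.disjoint_left.2 fun _ hi hj => hij (hi.2.symm.trans hj.2)

lemma measurable_blockStart (k : ℕ) : Measurable fun N : ℕ → ℕ => blockStart N k := by
  unfold blockStart; fun_prop

lemma measurable_bitPos (k : ℕ) : Measurable fun N : ℕ → ℕ => bitPos N k := by
  have := measurable_blockStart k
  unfold bitPos; fun_prop

lemma measurable_retainedBefore (n : ℕ) : Measurable fun D : ℕ → Bool => retainedBefore D n := by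
  have h : ∀ D : ℕ → Bool, retainedBefore D n = ∑ i ∈ Finset.range n, (!(D i)).toNat := by
    intro D
    rw [retainedBefore, Nat.count_eq_card_filter_range, Finset.card_filter]
    refine Finset.sum_congr rfl fun i _ => ?_
    cases D i <;> rfl
  simp_rw [h]
  refine Finset.measurable_sum _ fun i _ => ?_
  exact (Measurable.of_discrete (f := fun b : Bool => (!b).toNat)).comp (measurable_pi_apply i)

/-- Evaluating a family of measurable functions at a random natural number is measurable. -/
lemma measurable_comp_bitPos {α : Type*} [MeasurableSpace α] (F : ℕ → (ℕ → Bool) → α)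
    (hF : ∀ n, Measurable (F n)) (k : ℕ) :
    Measurable fun ω : ChannelSpace => F (bitPos ω.1 k) ω.2.2 := by
  have h1 : Measurable fun r : ℕ × (ℕ → Bool) => F r.1 r.2 := measurable_from_prod_countable_right hF
  exact h1.comp (((measurable_bitPos k).comp measurable_fst).prodMk
    (measurable_snd.comp measurable_snd))

lemma measurableSet_hitEvent (k j : ℕ) : MeasurableSet (hitEvent k j) := by
  have h1 : Measurable fun ω : ChannelSpace => ω.2.2 (bitPos ω.1 k) :=
    measurable_comp_bitPos (fun n D => D n) (fun n => measurable_pi_apply n) k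
  have h2 : Measurable fun ω : ChannelSpace => retainedBefore ω.2.2 (bitPos ω.1 k) :=
    measurable_comp_bitPos (fun n D => retainedBefore D n) measurable_retainedBefore k
  exact (h1 (measurableSet_singleton false)).inter (h2 (measurableSet_singleton j))

instance (q q' : unitInterval) : IsProbabilityMeasure (channelMeasure q q') := by
  unfold channelMeasure; infer_instance

/-! ### Infinite product measures -/

/-- A product of functions of finitely many coordinates has integral the product of integrals. -/
lemma integral_infinitePi_prod {E : Type*} [MeasurableSpace E]
    (μ : Measure E) [IsProbabilityMeasure μ] (s : Finset ℕ) (g : ℕ → E → ℂ)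
    (hg : ∀ i, Measurable (g i)) :
    ∫ x, ∏ i ∈ s, g i (x i) ∂(Measure.infinitePi fun _ : ℕ => μ) = ∏ i ∈ s, ∫ e, g i e ∂μ := by
  have h := integral_restrict_infinitePi (μ := fun _ : ℕ => μ) (s := s)
    (f := fun y => ∏ i : s, g i (y i))
    (Measurable.aestronglyMeasurable
      (Finset.measurable_fun_prod _ fun i _ => (hg i).comp (measurable_pi_apply i)))
  rw [integral_fintype_prod_eq_prod (fun (i : s) e => g i e)] at h
  rw [← Finset.prod_coe_sort s fun i => ∫ e, g i e ∂μ, ← h]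
  refine integral_congr_ae (ae_of_all _ fun x => ?_)
  exact (Finset.prod_coe_sort s fun i => g i (x i)).symm

lemma ae_infinite_retained {q : unitInterval} (hq : q < 1) :
    ∀ᵐ D ∂(Measure.infinitePi fun _ : ℕ => bernoulliMeasure true false q),
      {i | D i = false}.Infinite := by
  have key : ∀ n : ℕ, ∀ᵐ D ∂(Measure.infinitePi fun _ : ℕ => bernoulliMeasure true false q),
      ∃ i ≥ n, D i = false := by
    intro n
    have hle : ∀ l : ℕ, (Measure.infinitePi fun _ : ℕ => bernoulliMeasure true false q)
        {D | ¬ ∃ i ≥ n, D i = false} ≤ (unitInterval.toNNReal q : ENNReal) ^ l := by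
      intro l
      calc _ ≤ (Measure.infinitePi fun _ : ℕ => bernoulliMeasure true false q)
            (Set.pi (Finset.Ico n (n + l)) fun _ => {true}) := by
            refine measure_mono fun D hD i hi => ?_
            rw [Finset.coe_Ico, Set.mem_Ico] at hi
            by_contra h
            exact hD ⟨i, hi.1, by simpa using h⟩
        _ = _ := by
            rw [Measure.infinitePi_pi _ fun _ _ => measurableSet_singleton _]
            simp [bernoulliMeasure_apply_of_mem_of_notMem]
    refine le_antisymm (ge_of_tendsto' (ENNReal.tendsto_pow_atTop_nhds_zero_of_lt_one ?_) hle)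
      zero_le
    rw [ENNReal.coe_lt_one_iff]
    exact hq
  filter_upwards [ae_all_iff.2 key] with D hD
  exact Set.infinite_of_forall_exists_gt fun n => by
    obtain ⟨i, hi, h⟩ := hD (n + 1)
    exact ⟨i, h, hi⟩

lemma ae_infinite_retained_channel {q : unitInterval} (q' : unitInterval) (hq : q < 1) :
    ∀ᵐ ω ∂(channelMeasure q q'), {i | ω.2.2 i = false}.Infinite := by
  unfold channelMeasure
  exact (Measure.quasiMeasurePreserving_snd.ae (Measure.quasiMeasurePreserving_snd.ae
    (ae_infinite_retained hq)))

lemma hasSum_measureReal_iUnion {α : Type*} [MeasurableSpace α] (μ : Measure α)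
    [IsFiniteMeasure μ] {A : ℕ → Set α} (hA : ∀ k, MeasurableSet (A k))
    (hd : Pairwise (Function.onFun Disjoint A)) :
    HasSum (fun k => μ.real (A k)) (μ.real (⋃ k, A k)) := by
  have h := measure_iUnion hd hA (μ := μ)
  have hne : ∑' k, μ (A k) ≠ ⊤ := h ▸ measure_ne_top μ _
  have := ENNReal.hasSum_toReal hne
  rwa [← ENNReal.tsum_toReal_eq (fun a => measure_ne_top μ _), ← h] at this

/-! ### The difference of the trace bit probabilities of two strings -/

/-- The difference of two bits, as a real number. -/
def bitDiff (x y : ℕ → Bool) (k : ℕ) : ℝ :=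
  (if x k = true then 1 else 0) - (if y k = true then 1 else 0)

lemma abs_bitDiff_le (x y : ℕ → Bool) (k : ℕ) : |bitDiff x y k| ≤ 1 := by
  unfold bitDiff; split_ifs <;> norm_num

lemma bitDiff_eq_zero {x y : ℕ → Bool} {k : ℕ} (h : x k = y k) : bitDiff x y k = 0 := by
  simp [bitDiff, h]

lemma abs_bitDiff_eq_one {x y : ℕ → Bool} {k : ℕ} (h : x k ≠ y k) : |bitDiff x y k| = 1 := by
  unfold bitDiff; cases hx : x k <;> cases hy : y k <;> simp_all

lemma hasSum_measureReal_hitEvent (q q' : unitInterval) (x : ℕ → Bool) (j : ℕ) :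
    HasSum (fun k => (if x k = true then 1 else 0) * (channelMeasure q q').real (hitEvent k j))
      ((channelMeasure q q').real ({ω | trace ω x j = true} ∩ ⋃ k, hitEvent k j)) := by
  have hset : {ω | trace ω x j = true} ∩ ⋃ k, hitEvent k j =
      ⋃ k, if x k = true then hitEvent k j else ∅ := by
    ext ω
    simp only [Set.mem_inter_iff, Set.mem_ofPred_eq, Set.mem_iUnion]
    constructor
    · rintro ⟨h, k, hk⟩
      rw [trace_eq_of_mem_hitEvent hk] at h
      exact ⟨k, by simpa [h] using hk⟩
    · rintro ⟨k, hk⟩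
      split_ifs at hk with h
      · exact ⟨(trace_eq_of_mem_hitEvent hk x).trans h, k, hk⟩
      · exact hk.elim
  rw [hset]
  convert hasSum_measureReal_iUnion (channelMeasure q q')
    (A := fun k => if x k = true then hitEvent k j else ∅) ?_ ?_ using 2 with k
  · split_ifs <;> simp
  · intro k
    split_ifs
    exacts [measurableSet_hitEvent k j, .empty]
  · intro k l hkl
    have := pairwise_disjoint_hitEvent_left j hkl
    simp only [Function.onFun] at this ⊢
    split_ifs <;> simp [this]

/-- The coupling step: outside the hit events the two traces agree almost surely at `j`, so those
contributions cancel. -/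
lemma hasSum_traceBitProb_sub {q : unitInterval} (q' : unitInterval) (hq : q < 1)
    (x y : ℕ → Bool) (j : ℕ) :
    HasSum (fun k => bitDiff x y k * (channelMeasure q q').real (hitEvent k j))
      (traceBitProb q q' x j - traceBitProb q q' y j) := by
  have hm : MeasurableSet (⋃ k, hitEvent k j) := .iUnion fun k => measurableSet_hitEvent k j
  have hrest : (channelMeasure q q').real ({ω | trace ω x j = true} \ ⋃ k, hitEvent k j) =
      (channelMeasure q q').real ({ω | trace ω y j = true} \ ⋃ k, hitEvent k j) := by
    refine measureReal_congr ?_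
    filter_upwards [ae_infinite_retained_channel q' hq] with ω hω
    refine propext (and_congr_left fun h => ?_)
    have := trace_congr_of_notMem_hitEvent hω (fun k hk => h (Set.mem_iUnion.2 ⟨k, hk⟩)) x y
    change trace ω x j = true ↔ trace ω y j = true
    rw [this]
  have h := (hasSum_measureReal_hitEvent q q' x j).sub (hasSum_measureReal_hitEvent q q' y j)
  have heq : traceBitProb q q' x j - traceBitProb q q' y j =
      (channelMeasure q q').real ({ω | trace ω x j = true} ∩ ⋃ k, hitEvent k j) -
      (channelMeasure q q').real ({ω | trace ω y j = true} ∩ ⋃ k, hitEvent k j) := by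
    unfold traceBitProb
    rw [← measureReal_inter_add_sdiff (s := {ω | trace ω x j = true}) hm,
      ← measureReal_inter_add_sdiff (s := {ω | trace ω y j = true}) hm, hrest]
    ring
  rw [heq]
  simpa only [bitDiff, sub_mul] using h

/-! ### Generating functions of the channel -/

/-- `w` to the number of retained bits before position `n` if the bit there is retained, else `0`. -/
def retainedWeight (w : ℂ) (n : ℕ) (D : ℕ → Bool) : ℂ :=
  if D n = false then w ^ retainedBefore D n else 0

lemma measurable_retainedWeight (w : ℂ) (n : ℕ) : Measurable (retainedWeight w n) := by
  unfold retainedWeight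
  have hD : MeasurableSet {D : ℕ → Bool | D n = false} :=
    (measurable_pi_apply (X := fun _ : ℕ => Bool) n) (measurableSet_singleton false)
  refine Measurable.ite hD ?_ measurable_const
  exact (Measurable.of_discrete (f := fun j : ℕ => w ^ j)).comp (measurable_retainedBefore n)

lemma norm_retainedWeight_le {w : ℂ} (hw : ‖w‖ ≤ 1) (n : ℕ) (D : ℕ → Bool) :
    ‖retainedWeight w n D‖ ≤ 1 := by
  unfold retainedWeight
  split_ifs
  · rw [norm_pow]; exact pow_le_one₀ (norm_nonneg _) hw
  · simp

/-- By independence each of the `n` earlier bits contributes a factor `q + (1 - q) w`, and retaining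
the bit at `n` contributes `1 - q`. -/
lemma integral_retainedWeight (q : unitInterval) (w : ℂ) (n : ℕ) :
    ∫ D, retainedWeight w n D ∂(Measure.infinitePi fun _ : ℕ => bernoulliMeasure true false q) =
      (1 - (q : ℝ) : ℝ) * ((q : ℝ) + (1 - (q : ℝ) : ℝ) * w) ^ n := by
  set g : ℕ → Bool → ℂ := fun i b =>
    if i = n then (if b = false then 1 else 0) else (if b = false then w else 1) with hg
  have h : ∀ D, retainedWeight w n D = ∏ i ∈ Finset.range (n + 1), g i (D i) := by
    intro D
    have h1 : ∏ i ∈ Finset.range n, g i (D i) = w ^ retainedBefore D n := by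
      rw [retainedBefore, Nat.count_eq_card_filter_range, ← Finset.prod_const, Finset.prod_filter]
      refine Finset.prod_congr rfl fun i hi => ?_
      simp [hg, (Finset.mem_range.1 hi).ne]
    rw [Finset.prod_range_succ, h1]
    simp [hg, retainedWeight]
  simp_rw [h]
  rw [integral_infinitePi_prod _ _ _ fun i => Measurable.of_discrete, Finset.prod_range_succ]
  have h2 : ∀ i ∈ Finset.range n, ∫ b, g i b ∂(bernoulliMeasure true false q) =
      (q : ℝ) + (1 - (q : ℝ) : ℝ) * w := by
    intro i hi
    rw [integral_bernoulliMeasure]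
    simp [hg, (Finset.mem_range.1 hi).ne]
  rw [Finset.prod_congr rfl h2, integral_bernoulliMeasure]
  simp [hg, mul_comm]

lemma integral_pow_geometricMeasure {p : unitInterval} (hp : 0 < p) {u : ℂ} (hu : ‖u‖ ≤ 1) :
    ∫ n, u ^ n ∂(geometricMeasure p) = (p : ℝ) / (1 - (1 - (p : ℝ) : ℝ) * u) := by
  rw [integral_geometricMeasure hp.ne']
  have h1 : ‖((1 - (p : ℝ) : ℝ) : ℂ) * u‖ < 1 := by
    have h0 : 0 < (p : ℝ) := hp
    have h2 := p.2.2
    rw [norm_mul, Complex.norm_real, Real.norm_of_nonneg (by linarith)]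
    nlinarith [norm_nonneg u]
  rw [div_eq_mul_inv, ← tsum_geometric_of_norm_lt_one h1, ← tsum_mul_left]
  refine tsum_congr fun n => ?_
  rw [Complex.real_smul, mul_pow]
  push_cast
  ring

/-- The generating function of the length of a block. -/
def blockPGF (q' : unitInterval) (u : ℂ) : ℂ :=
  (1 - (q' : ℝ) : ℝ) * u / (1 - (q' : ℝ) * u)

/-- There are `k` complete blocks before the bit; its own block contributes only the insertions,
hence a last factor without `u` in the numerator. -/
lemma integral_pow_bitPos {q' : unitInterval} (hq' : q' < 1) {u : ℂ} (hu : ‖u‖ ≤ 1) (k : ℕ) :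
    ∫ N, u ^ bitPos N k
        ∂(Measure.infinitePi fun _ : ℕ => geometricMeasure (unitInterval.symm q')) =
      blockPGF q' u ^ k * ((1 - (q' : ℝ) : ℝ) / (1 - (q' : ℝ) * u)) := by
  have hp : 0 < unitInterval.symm q' := by
    rw [← Subtype.coe_lt_coe] at hq' ⊢
    simpa using hq'
  have hE := integral_pow_geometricMeasure hp hu
  simp only [unitInterval.coe_symm_eq, sub_sub_cancel] at hE
  set g : ℕ → ℕ → ℂ := fun i n => if i = k then u ^ n else u ^ (n + 1) with hg
  have h : ∀ N, u ^ bitPos N k = ∏ i ∈ Finset.range (k + 1), g i (N i) := by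
    intro N
    have h1 : ∏ i ∈ Finset.range k, g i (N i) = u ^ blockStart N k := by
      rw [blockStart, ← Finset.prod_pow_eq_pow_sum]
      refine Finset.prod_congr rfl fun i hi => ?_
      simp [hg, (Finset.mem_range.1 hi).ne]
    rw [Finset.prod_range_succ, h1, bitPos, pow_add]
    simp [hg]
  simp_rw [h]
  rw [integral_infinitePi_prod _ _ _ fun i => Measurable.of_discrete, Finset.prod_range_succ]
  have h2 : ∀ i ∈ Finset.range k, ∫ n, g i n ∂(geometricMeasure (unitInterval.symm q')) =
      blockPGF q' u := by
    intro i hi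
    simp only [hg, (Finset.mem_range.1 hi).ne, if_false, pow_succ]
    rw [integral_mul_const, hE, blockPGF]
    ring
  rw [Finset.prod_congr rfl h2]
  simp [hg, hE]

lemma norm_affine_le (q : unitInterval) {w : ℂ} (hw : ‖w‖ ≤ 1) :
    ‖((q : ℝ) : ℂ) + (1 - (q : ℝ) : ℝ) * w‖ ≤ 1 := by
  have h0 := q.2.1
  have h1 := q.2.2
  refine (norm_add_le _ _).trans ?_
  rw [norm_mul, Complex.norm_real, Complex.norm_real, Real.norm_of_nonneg h0,
    Real.norm_of_nonneg (by linarith)]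
  nlinarith

lemma integral_retainedWeight_bitPos (q : unitInterval) {q' : unitInterval} (hq' : q' < 1) {w : ℂ}
    (hw : ‖w‖ ≤ 1) (k : ℕ) :
    ∫ ω, retainedWeight w (bitPos ω.1 k) ω.2.2 ∂(channelMeasure q q') =
      (1 - (q : ℝ) : ℝ) *
        (blockPGF q' ((q : ℝ) + (1 - (q : ℝ) : ℝ) * w) ^ k *
          ((1 - (q' : ℝ) : ℝ) / (1 - (q' : ℝ) * ((q : ℝ) + (1 - (q : ℝ) : ℝ) * w)))) := by
  have hint : Integrable (fun ω : ChannelSpace => retainedWeight w (bitPos ω.1 k) ω.2.2)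
      (channelMeasure q q') :=
    .of_bound (measurable_comp_bitPos _ (measurable_retainedWeight w) k).aestronglyMeasurable 1
      (ae_of_all _ fun ω => norm_retainedWeight_le hw _ _)
  rw [← integral_pow_bitPos hq' (norm_affine_le q hw), ← integral_const_mul]
  unfold channelMeasure at hint ⊢
  rw [integral_prod _ hint]
  refine integral_congr_ae (ae_of_all _ fun N => ?_)
  simp only
  rw [← integral_retainedWeight q w (bitPos N k), integral_fun_snd]
  simp

lemma hasSum_pow_mul_measureReal_hitEvent (q : unitInterval) {q' : unitInterval} (hq' : q' < 1)
    {w : ℂ} (hw : ‖w‖ ≤ 1) (k : ℕ) :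
    HasSum (fun j => w ^ j * ((channelMeasure q q').real (hitEvent k j) : ℂ))
      ((1 - (q : ℝ) : ℝ) *
        (blockPGF q' ((q : ℝ) + (1 - (q : ℝ) : ℝ) * w) ^ k *
          ((1 - (q' : ℝ) : ℝ) / (1 - (q' : ℝ) * ((q : ℝ) + (1 - (q : ℝ) : ℝ) * w))))) := by
  rw [← integral_retainedWeight_bitPos q hq' hw k]
  have hint : Integrable (fun ω : ChannelSpace => retainedWeight w (bitPos ω.1 k) ω.2.2)
      (channelMeasure q q') :=
    .of_bound (measurable_comp_bitPos _ (measurable_retainedWeight w) k).aestronglyMeasurable 1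
      (ae_of_all _ fun ω => norm_retainedWeight_le hw _ _)
  have h := hasSum_integral_iUnion (measurableSet_hitEvent k) (pairwise_disjoint_hitEvent_right k)
    hint.integrableOn
  rw [setIntegral_eq_integral_of_forall_compl_eq_zero] at h
  · convert! h using 2
    rename_i j
    rw [setIntegral_congr_fun (measurableSet_hitEvent k j)
      (g := fun _ => w ^ j) fun ω hω => ?_, setIntegral_const, Complex.real_smul, mul_comm]
    simp [retainedWeight, hω.1, hω.2]
  · intro ω hω
    refine if_neg fun h => hω (Set.mem_iUnion.2 ⟨_, h, rfl⟩)

lemma tsum_measureReal_hitEvent_le (q q' : unitInterval) (j : ℕ) :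
    ∑' k, (channelMeasure q q').real (hitEvent k j) ≤ 1 := by
  rw [(hasSum_measureReal_iUnion _ (fun k => measurableSet_hitEvent k j)
    (pairwise_disjoint_hitEvent_left j)).tsum_eq]
  exact measureReal_le_one

/-- Supplies the domination needed to exchange the sums over trace positions and input positions. -/
lemma summable_pow_mul_of_tsum_le_one {P : ℕ → ℕ → ℝ} (hP0 : ∀ j k, 0 ≤ P j k)
    (hPs : ∀ j, Summable (P j)) (hP1 : ∀ j, ∑' k, P j k ≤ 1) {r : ℝ} (hr0 : 0 ≤ r) (hr : r < 1) :
    Summable fun i : ℕ × ℕ => r ^ i.1 * P i.1 i.2 := by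
  have h0 : ∀ j k, 0 ≤ r ^ j * P j k :=
    fun j k => mul_nonneg (pow_nonneg hr0 j) (hP0 j k)
  have h1 : Summable fun j => ∑' k, r ^ j * P j k := by
    refine Summable.of_nonneg_of_le (fun j => tsum_nonneg (h0 j)) (fun j => ?_)
      (summable_geometric_of_lt_one hr0 hr)
    rw [tsum_mul_left]
    exact mul_le_of_le_one_right (pow_nonneg hr0 _) (hP1 j)
  have hnn : (0 : ℕ × ℕ → ℝ) ≤ fun i => r ^ i.1 * P i.1 i.2 := fun i => h0 i.1 i.2
  rw [summable_prod_of_nonneg hnn]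
  exact ⟨fun j => (hPs j).mul_left (r ^ j), h1⟩

/-- The generating function of the difference of the trace bit probabilities of two strings. -/
lemma hasSum_pow_mul_traceBitProb_sub {q q' : unitInterval} (hq : q < 1) (hq' : q' < 1)
    {w : ℂ} (hw : ‖w‖ < 1) (x y : ℕ → Bool) :
    HasSum (fun j => w ^ j * ((traceBitProb q q' x j - traceBitProb q q' y j : ℝ) : ℂ))
      ((1 - (q : ℝ) : ℝ) *
        ((1 - (q' : ℝ) : ℝ) / (1 - (q' : ℝ) * ((q : ℝ) + (1 - (q : ℝ) : ℝ) * w))) *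
          ∑' k, bitDiff x y k * blockPGF q' ((q : ℝ) + (1 - (q : ℝ) : ℝ) * w) ^ k) := by
  obtain ⟨P, hP⟩ : ∃ P : ℕ → ℕ → ℝ, ∀ j k, (channelMeasure q q').real (hitEvent k j) = P j k :=
    ⟨_, fun _ _ => rfl⟩
  have hP0 : ∀ j k, 0 ≤ P j k := fun j k => hP j k ▸ measureReal_nonneg
  have hPs : ∀ j, Summable (P j) := fun j => by
    simpa only [hP] using (hasSum_measureReal_iUnion (channelMeasure q q')
      (fun k => measurableSet_hitEvent k j) (pairwise_disjoint_hitEvent_left j)).summable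
  have hP1 : ∀ j, ∑' k, P j k ≤ 1 := fun j => by
    simpa only [hP] using tsum_measureReal_hitEvent_le q q' j
  have hrow := fun j => (Complex.hasSum_ofReal.2 (hasSum_traceBitProb_sub q' hq x y j)).mul_left
    (w ^ j)
  have hgf := fun k => (hasSum_pow_mul_measureReal_hitEvent q hq' hw.le k).tsum_eq
  simp only [hP] at hrow hgf
  have hsum : Summable (Function.uncurry fun j k => w ^ j * ((bitDiff x y k * P j k : ℝ) : ℂ)) := by
    refine .of_norm_bounded (summable_pow_mul_of_tsum_le_one hP0 hPs hP1 (norm_nonneg w) hw)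
      fun r => ?_
    simp only [Function.uncurry, norm_mul, norm_pow, Complex.norm_real, Real.norm_eq_abs,
      abs_of_nonneg (hP0 _ _)]
    refine mul_le_mul_of_nonneg_left ?_ (by positivity)
    exact mul_le_of_le_one_left (hP0 _ _) (abs_bitDiff_le x y _)
  have hcol : ∀ k, ∑' j, w ^ j * ((bitDiff x y k * P j k : ℝ) : ℂ) =
      bitDiff x y k * ∑' j, w ^ j * (P j k : ℂ) := fun k => by
    rw [← tsum_mul_left]
    refine tsum_congr fun j => ?_
    push_cast
    ring
  -- Rows (fixed `j`) give the trace differences; columns (fixed `k`) give the closed form in `z ^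
  -- k`.
  have hdouble := hsum.hasSum.prod_fiberwise hrow
  rw [hsum.tsum_prod] at hdouble
  simp only [Function.uncurry] at hdouble
  rw [← hsum.tsum_comm] at hdouble
  rw [← tsum_mul_left]
  convert! hdouble using 1
  refine tsum_congr fun k => ?_
  rw [hcol, hgf k]
  ring

/-! ### Lower bounds for power series with bounded coefficients on short arcs -/

/-- The power series with the given real coefficients. -/
def realPowerSeries (c : ℕ → ℝ) (z : ℂ) : ℂ := ∑' k, (c k : ℂ) * z ^ k

lemma norm_realPowerSeries_term_le {c : ℕ → ℝ} (hc : ∀ k, |c k| ≤ 1) (k : ℕ) (z : ℂ) :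
    ‖(c k : ℂ) * z ^ k‖ ≤ ‖z‖ ^ k := by
  rw [norm_mul, norm_pow, Complex.norm_real]
  exact mul_le_of_le_one_left (by positivity) (hc k)

lemma summable_realPowerSeries {c : ℕ → ℝ} (hc : ∀ k, |c k| ≤ 1) {z : ℂ}
    (hz : ‖z‖ < 1) : Summable fun k => (c k : ℂ) * z ^ k :=
  .of_norm_bounded (summable_geometric_of_lt_one (norm_nonneg z) hz)
    fun k => norm_realPowerSeries_term_le hc k z

lemma norm_realPowerSeries_le {c : ℕ → ℝ} (hc : ∀ k, |c k| ≤ 1) {z : ℂ}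
    (hz : ‖z‖ < 1) : ‖realPowerSeries c z‖ ≤ (1 - ‖z‖)⁻¹ :=
  tsum_of_norm_bounded (hasSum_geometric_of_lt_one (norm_nonneg z) hz)
    fun k => norm_realPowerSeries_term_le hc k z

lemma differentiableAt_realPowerSeries {c : ℕ → ℝ} (hc : ∀ k, |c k| ≤ 1) {z : ℂ}
    (hz : ‖z‖ < 1) :
    DifferentiableAt ℂ (realPowerSeries c) z := by
  obtain ⟨ρ, hzρ, hρ⟩ := exists_between hz
  have h : DifferentiableOn ℂ (realPowerSeries c) (Metric.ball 0 ρ) :=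
    Complex.differentiableOn_tsum_of_summable_norm (u := fun k => ρ ^ k)
      (summable_geometric_of_lt_one ((norm_nonneg z).trans hzρ.le) hρ) (fun k => by fun_prop)
      Metric.isOpen_ball fun k y hy => (norm_realPowerSeries_term_le hc k y).trans
        (pow_le_pow_left₀ (norm_nonneg y) (by simpa using (mem_ball_zero_iff.1 hy).le) k)
  exact h.differentiableAt (Metric.isOpen_ball.mem_nhds (by simpa using hzρ))

/-- If the first `n` coefficients vanish, a power of `z` factors out. -/
lemma realPowerSeries_eq_pow_mul {c : ℕ → ℝ} (hc : ∀ k, |c k| ≤ 1) {n : ℕ}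
    (h0 : ∀ k < n, c k = 0) {z : ℂ} (hz : ‖z‖ < 1) :
    realPowerSeries c z = z ^ n * realPowerSeries (fun k => c (n + k)) z := by
  unfold realPowerSeries
  rw [← (summable_realPowerSeries hc hz).sum_add_tsum_nat_add n, Finset.sum_eq_zero, zero_add,
    ← tsum_mul_left]
  · refine tsum_congr fun k => ?_
    rw [add_comm k n, pow_add]
    ring
  · intro k hk
    simp [h0 k (Finset.mem_range.1 hk)]

lemma norm_one_add_sq_add_norm_one_sub_sq (v : ℂ) :
    ‖1 + v‖ ^ 2 + ‖1 - v‖ ^ 2 = 2 + 2 * ‖v‖ ^ 2 := by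
  have := parallelogram_law_with_norm ℝ (1 : ℂ) v
  simp only [norm_one] at this
  linarith

/-- A self-map of the unit disc that fixes `0` and `1`, and whose image touches the unit circle only
at `1`. -/
def discMap (v : ℂ) : ℂ := (v + v ^ 2) / 2

lemma norm_discMap (v : ℂ) : ‖discMap v‖ = ‖v‖ * ‖1 + v‖ / 2 := by
  rw [discMap, show v + v ^ 2 = v * (1 + v) by ring, norm_div, norm_mul]
  simp

/-- The parallelogram law gives `‖1 + v‖ ^ 2 ≤ 4 - ‖1 - v‖ ^ 2`, and `√(4 - t) ≤ 2 - t / 4`. -/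
lemma norm_discMap_le {v : ℂ} (hv : ‖v‖ ≤ 1) : ‖discMap v‖ ≤ 1 - ‖1 - v‖ ^ 2 / 8 := by
  have h := norm_one_add_sq_add_norm_one_sub_sq v
  rw [norm_discMap]
  nlinarith [norm_nonneg v, norm_nonneg (1 + v), norm_nonneg (1 - v), sq_nonneg (‖1 + v‖ - 2),
    mul_le_mul_of_nonneg_right hv (norm_nonneg (1 + v)), pow_le_one₀ (norm_nonneg v) hv (n := 2)]

lemma norm_discMap_lt_one {v : ℂ} (hv : ‖v‖ < 1) : ‖discMap v‖ < 1 := by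
  have h : v ≠ 1 := by rintro rfl; simp at hv
  have : 0 < ‖1 - v‖ := norm_pos_iff.2 (sub_ne_zero.2 h.symm)
  have := norm_discMap_le hv.le
  have : 0 < ‖1 - v‖ ^ 2 := by positivity
  linarith

/-- This is why `discMap` is used: the series is bounded by `1 / (1 - ‖discMap v‖)`, whose blow-up
at `v = 1` is cancelled by `(1 - v) ^ 2`. The bound is uniform up to the unit circle. -/
lemma norm_sq_mul_realPowerSeries_discMap_le {c : ℕ → ℝ} (hc : ∀ k, |c k| ≤ 1) {v : ℂ}
    (hv : ‖v‖ < 1) : ‖(1 - v) ^ 2 * realPowerSeries c (discMap v)‖ ≤ 8 := by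
  have h1 := norm_discMap_lt_one hv
  have h2 := norm_discMap_le hv.le
  rw [norm_mul, norm_pow]
  refine (mul_le_mul_of_nonneg_left (norm_realPowerSeries_le hc h1) (by positivity)).trans ?_
  rw [← div_eq_mul_inv, div_le_iff₀ (by linarith)]
  linarith

/-- Some rotation by an `N`th root of unity brings a point into a given arc of length `2π/N`. -/
lemma exists_rotation_mem_arc {N : ℕ} (hN : 0 < N) (v : ℂ) :
    ∃ j < N, ∃ τ : ℝ, |τ| ≤ Real.pi / N ∧
      Complex.exp (2 * Real.pi * Complex.I / N) ^ j * v = ‖v‖ * Complex.exp (τ * Complex.I) := by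
  have hN' : (0 : ℝ) < N := by exact_mod_cast hN
  have hζ := Complex.isPrimitiveRoot_exp N hN.ne'
  set ζ := Complex.exp (2 * Real.pi * Complex.I / N) with hζdef
  -- The multiple of `2π / N` nearest to the argument; rotating back by it leaves an angle of at
  -- most `π / N`.
  set n : ℤ := round (v.arg * N / (2 * Real.pi)) with hn
  have hNz : (0 : ℤ) < N := by exact_mod_cast hN
  refine ⟨((-n) % N).toNat, ?_, v.arg - 2 * Real.pi * n / N, ?_, ?_⟩
  · have := Int.emod_lt_of_pos (-n) hNz
    have := Int.emod_nonneg (-n) hNz.ne'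
    omega
  · have h := abs_sub_round (v.arg * N / (2 * Real.pi))
    rw [← hn] at h
    have h2 : v.arg - 2 * Real.pi * n / N =
        (v.arg * N / (2 * Real.pi) - n) * (2 * Real.pi / N) := by
      field_simp
    rw [h2, abs_mul, abs_of_pos (a := 2 * Real.pi / N) (by positivity)]
    calc _ ≤ 1 / 2 * (2 * Real.pi / N) := by gcongr
      _ = _ := by ring
  · have h1 : ζ ^ ((-n) % N).toNat = ζ ^ (-n) := by
      rw [← zpow_natCast, Int.toNat_of_nonneg (Int.emod_nonneg _ hNz.ne')]
      conv_rhs => rw [← Int.emod_add_mul_ediv (-n) N, zpow_add₀ (hζ.ne_zero hN.ne'), zpow_mul,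
        zpow_natCast, hζ.pow_eq_one, one_zpow, mul_one]
    rw [h1, hζdef, ← Complex.exp_int_mul]
    conv_lhs => rw [← Complex.norm_mul_exp_arg_mul_I v]
    rw [mul_left_comm, ← Complex.exp_add]
    congr 2
    push_cast
    ring

/-- A power series with coefficients bounded by `1` and constant coefficient `±1` is at least
exponentially small in `1 / (arc length)` somewhere on the image of any arc around the real axis. -/
lemma exists_le_norm_realPowerSeries_on_arc {c : ℕ → ℝ} (hc : ∀ k, |c k| ≤ 1) (hc0 : |c 0| = 1)
    {N : ℕ} (hN : 0 < N) {r : ℝ} (hr0 : 0 < r) (hr : r < 1) :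
    ∃ τ : ℝ, |τ| ≤ Real.pi / N ∧ (1 / 8 : ℝ) ^ N ≤
      4 * ‖realPowerSeries c (discMap (r * Complex.exp (τ * Complex.I)))‖ := by
  set g : ℂ → ℂ := fun v => (1 - v) ^ 2 * realPowerSeries c (discMap v) with hg
  set ζ := Complex.exp (2 * Real.pi * Complex.I / N) with hζdef
  have hζ : ‖ζ‖ = 1 := (Complex.isPrimitiveRoot_exp N hN.ne').norm'_eq_one hN.ne'
  have hrot : ∀ (j : ℕ) (v : ℂ), ‖ζ ^ j * v‖ = ‖v‖ := fun j v => by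
    rw [norm_mul, norm_pow, hζ, one_pow, one_mul]
  have hgd : ∀ v : ℂ, ‖v‖ < 1 → DifferentiableAt ℂ g v := fun v hv => by
    have h1 := differentiableAt_realPowerSeries hc (norm_discMap_lt_one hv)
    have h2 : DifferentiableAt ℂ discMap v := by unfold discMap; fun_prop
    exact (((differentiableAt_const _).sub differentiableAt_id).pow 2).mul (h1.comp v h2)
  -- The product over all rotations has modulus `1` at `0`, hence at least `1` somewhere on the
  -- circle of radius `r`. One of its factors is evaluated on the arc and the others are at most
  -- `8`.
  have hGd : DiffContOnCl ℂ (fun v => ∏ j ∈ Finset.range N, g (ζ ^ j * v)) (Metric.ball 0 r) := by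
    refine DifferentiableOn.diffContOnCl fun v hv => DifferentiableAt.differentiableWithinAt ?_
    rw [closure_ball _ hr0.ne', mem_closedBall_zero_iff] at hv
    refine DifferentiableAt.fun_finsetProd fun j _ => ?_
    refine DifferentiableAt.comp v (hgd _ ?_) (by fun_prop)
    rw [hrot]; exact hv.trans_lt hr
  obtain ⟨v, hv, hmax⟩ := Complex.exists_mem_frontier_isMaxOn_norm Metric.isBounded_ball
    ⟨0, Metric.mem_ball_self hr0⟩ hGd
  rw [frontier_ball _ hr0.ne', mem_sphere_zero_iff_norm] at hv
  have hg0 : ‖g 0‖ = 1 := by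
    have : realPowerSeries c 0 = c 0 := by
      rw [realPowerSeries, tsum_eq_single 0 fun k hk => by simp [hk]]
      simp
    simp [hg, discMap, this, hc0]
  have h1 : 1 ≤ ∏ j ∈ Finset.range N, ‖g (ζ ^ j * v)‖ := by
    have := hmax (subset_closure (Metric.mem_ball_self hr0))
    simpa [norm_prod, hg0] using this
  obtain ⟨j, hj, τ, hτ, hjτ⟩ := exists_rotation_mem_arc hN v
  rw [← hζdef, hv] at hjτ
  refine ⟨τ, hτ, ?_⟩
  rw [← hjτ]
  rw [← Finset.mul_prod_erase _ _ (Finset.mem_range.2 hj)] at h1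
  have h2 : ∏ i ∈ (Finset.range N).erase j, ‖g (ζ ^ i * v)‖ ≤ 8 ^ (N - 1) := by
    refine (Finset.prod_le_prod (g := fun _ => (8 : ℝ)) (fun i _ => norm_nonneg _)
      fun i _ => ?_).trans_eq ?_
    · refine norm_sq_mul_realPowerSeries_discMap_le hc ?_
      rw [hrot, hv]; exact hr
    · rw [Finset.prod_const, Finset.card_erase_of_mem (Finset.mem_range.2 hj), Finset.card_range]
  have h3 : ‖g (ζ ^ j * v)‖ ≤ 4 * ‖realPowerSeries c (discMap (ζ ^ j * v))‖ := by
    rw [hg, norm_mul, norm_pow]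
    refine mul_le_mul_of_nonneg_right ?_ (norm_nonneg _)
    have : ‖1 - ζ ^ j * v‖ ≤ 2 := (norm_sub_le _ _).trans (by rw [hrot, hv, norm_one]; linarith)
    nlinarith [norm_nonneg (1 - ζ ^ j * v)]
  refine le_trans ?_ h3
  have h4 : 1 ≤ ‖g (ζ ^ j * v)‖ * 8 ^ N := by
    refine h1.trans (mul_le_mul_of_nonneg_left (h2.trans ?_) (norm_nonneg _))
    exact pow_le_pow_right₀ (by norm_num) (by omega)
  rw [one_div, inv_pow, inv_le_iff_one_le_mul₀ (by positivity)]
  exact h4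

/-! ### Geometry of the arc near `1` -/

/-- Moving by order `ε` along the arc costs only order `ε ^ 2` in modulus, since by the
parallelogram law the loss in `‖discMap v‖` is quadratic in `‖1 - v‖`. -/
lemma arc_geometry {κ ε τ : ℝ} (hκ0 : 0 < κ) (hκ : κ ≤ 1 / 256) (hε0 : 0 < ε) (hε : ε ≤ 1)
    (hτ : |τ| ≤ 4 * κ * ε) {z : ℂ}
    (hz : z = discMap (((1 - κ * ε ^ 2 : ℝ) : ℂ) * Complex.exp (τ * Complex.I))) :
    κ * ε ^ 2 ≤ (1 - z).re ∧ ‖1 - z‖ ≤ 8 * κ * ε ∧ 1 - 10 * κ * ε ^ 2 ≤ ‖z‖ ∧ ‖z‖ < 1 := by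
  have hs0 : 0 < κ * ε ^ 2 := by positivity
  have hs1 : κ * ε ^ 2 ≤ κ * ε := by nlinarith
  have hs2 : κ * ε ≤ κ := by nlinarith
  set r : ℝ := 1 - κ * ε ^ 2 with hr
  have hr0 : 0 < r := by linarith
  set v : ℂ := (r : ℂ) * Complex.exp (τ * Complex.I) with hv
  have hvn : ‖v‖ = r := by
    rw [hv, norm_mul, Complex.norm_exp_ofReal_mul_I, mul_one, Complex.norm_real,
      Real.norm_of_nonneg hr0.le]
  have h1v : ‖1 - v‖ ≤ 5 * κ * ε := by
    have he : ‖Complex.exp (τ * Complex.I) - 1‖ ≤ |τ| := by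
      rw [mul_comm]; exact Real.norm_exp_I_mul_ofReal_sub_one_le
    have : 1 - v = ((1 - r : ℝ) : ℂ) - r * (Complex.exp (τ * Complex.I) - 1) := by
      rw [hv]; push_cast; ring
    rw [this]
    refine (norm_sub_le _ _).trans ?_
    rw [norm_mul, Complex.norm_real, Complex.norm_real, Real.norm_of_nonneg hr0.le,
      Real.norm_of_nonneg (by linarith)]
    nlinarith [norm_nonneg (Complex.exp (τ * Complex.I) - 1)]
  have hzlt : ‖z‖ < 1 := hz ▸ norm_discMap_lt_one (by rw [hvn]; linarith)
  have hzle : ‖z‖ ≤ r := by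
    have : ‖1 + v‖ ≤ 1 + r := (norm_add_le _ _).trans (by rw [hvn, norm_one])
    rw [hz, norm_discMap, hvn]
    nlinarith
  refine ⟨?_, ?_, ?_, hzlt⟩
  · have := (Complex.re_le_norm z).trans hzle
    rw [Complex.sub_re, Complex.one_re]
    linarith
  · have h2 : 1 - z = (1 - v) * (2 + v) / 2 := by rw [hz, discMap]; ring
    have h3 : ‖2 + v‖ ≤ 3 := (norm_add_le _ _).trans (by rw [hvn]; norm_num; linarith)
    rw [h2, norm_div, norm_mul]
    norm_num
    nlinarith [norm_nonneg (1 - v), norm_nonneg (2 + v)]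
  · have h4 := norm_one_add_sq_add_norm_one_sub_sq v
    rw [hvn] at h4
    have h5 : ‖z‖ ^ 2 = r ^ 2 * (2 + 2 * r ^ 2 - ‖1 - v‖ ^ 2) / 4 := by
      rw [hz, norm_discMap, hvn, ← h4]; ring
    have h6 : ‖1 - v‖ ^ 2 ≤ κ * ε ^ 2 := by
      calc ‖1 - v‖ ^ 2 ≤ (5 * κ * ε) ^ 2 := by gcongr
        _ = 25 * κ * (κ * ε ^ 2) := by ring
        _ ≤ κ * ε ^ 2 := mul_le_of_le_one_left hs0.le (by linarith)
    have h7 : 1 - 2 * (κ * ε ^ 2) ≤ r ^ 2 := by rw [hr]; nlinarith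
    have h8 : 1 - 10 * κ * ε ^ 2 ≤ ‖z‖ ^ 2 := by
      rw [h5]
      have h9 : 4 - 5 * (κ * ε ^ 2) ≤ 2 + 2 * r ^ 2 - ‖1 - v‖ ^ 2 := by linarith
      have h10 : (1 - 2 * (κ * ε ^ 2)) * (4 - 5 * (κ * ε ^ 2)) ≤
          r ^ 2 * (2 + 2 * r ^ 2 - ‖1 - v‖ ^ 2) :=
        mul_le_mul h7 h9 (by linarith) (sq_nonneg r)
      nlinarith
    nlinarith [norm_nonneg z]

/-! ### Inverting the Möbius change of variables -/

/-- The preimage of `z` under the Möbius map `w ↦ blockPGF q' (q + (1 - q) w)`. -/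
def blockPreimage (q q' : unitInterval) (z : ℂ) : ℂ :=
  1 - ((1 - (q' : ℝ) : ℝ) / (1 - (q : ℝ) : ℝ)) * ((1 - z) / (1 - (q' : ℝ) * (1 - z)))

lemma one_half_le_norm_one_sub_mul (q' : unitInterval) {z : ℂ} (hz : ‖1 - z‖ ≤ 1 / 2) :
    1 / 2 ≤ ‖1 - ((q' : ℝ) : ℂ) * (1 - z)‖ := by
  have h := norm_sub_norm_le (1 : ℂ) (((q' : ℝ) : ℂ) * (1 - z))
  rw [norm_mul, Complex.norm_real, Real.norm_of_nonneg q'.2.1, norm_one] at h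
  nlinarith [q'.2.2, q'.2.1, norm_nonneg (1 - z)]

lemma affine_blockPreimage {q : unitInterval} (q' : unitInterval) (hq : q < 1) {z : ℂ}
    (hz : ‖1 - z‖ ≤ 1 / 2) :
    (q : ℝ) + (1 - (q : ℝ) : ℝ) * blockPreimage q q' z = z / (1 - (q' : ℝ) * (1 - z)) := by
  have h1 : (1 - ((q' : ℝ) : ℂ) * (1 - z)) ≠ 0 := fun h => by
    have := one_half_le_norm_one_sub_mul q' hz
    rw [h, norm_zero] at this; norm_num at this
  have h2 : (1 : ℂ) - (q : ℝ) ≠ 0 := by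
    have : (q : ℝ) < 1 := hq
    exact_mod_cast (sub_pos.2 this).ne'
  rw [blockPreimage]
  push_cast
  field_simp
  ring

lemma one_sub_mul_affine_blockPreimage {q : unitInterval} (q' : unitInterval) (hq : q < 1) {z : ℂ}
    (hz : ‖1 - z‖ ≤ 1 / 2) :
    1 - (q' : ℝ) * ((q : ℝ) + (1 - (q : ℝ) : ℝ) * blockPreimage q q' z) =
      (1 - (q' : ℝ) : ℝ) / (1 - (q' : ℝ) * (1 - z)) := by
  have h1 : (1 - ((q' : ℝ) : ℂ) * (1 - z)) ≠ 0 := fun h => by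
    have := one_half_le_norm_one_sub_mul q' hz
    rw [h, norm_zero] at this; norm_num at this
  rw [affine_blockPreimage q' hq hz]
  push_cast
  field_simp
  ring

lemma blockPGF_affine_blockPreimage {q q' : unitInterval} (hq : q < 1) (hq' : q' < 1) {z : ℂ}
    (hz : ‖1 - z‖ ≤ 1 / 2) :
    blockPGF q' ((q : ℝ) + (1 - (q : ℝ) : ℝ) * blockPreimage q q' z) = z := by
  have h1 : (1 - ((q' : ℝ) : ℂ) * (1 - z)) ≠ 0 := fun h => by
    have := one_half_le_norm_one_sub_mul q' hz
    rw [h, norm_zero] at this; norm_num at this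
  have h2 : ((1 - (q' : ℝ) : ℝ) : ℂ) ≠ 0 := by
    have : (q' : ℝ) < 1 := hq'
    exact_mod_cast (sub_pos.2 this).ne'
  rw [blockPGF, one_sub_mul_affine_blockPreimage q' hq hz, affine_blockPreimage q' hq hz]
  field_simp

/-- Expanding `‖w‖ ^ 2` around `1`, the linear gain is at least `2μκε²`. The quadratic errors total
at most `4μ(1 + μ)‖1 - z‖²`, and `κ(1 + μ) = 1/256` is chosen so that they consume at most half of
it. -/
lemma norm_blockPreimage_le {q q' : unitInterval} (hq : q < 1) (hq' : q' < 1) {μ κ ε : ℝ} {z : ℂ}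
    (hμ : μ = (1 - (q' : ℝ)) / (1 - (q : ℝ))) (hκ : κ = 1 / (256 * (1 + μ)))
    (hε0 : 0 < ε) (hε : ε ≤ 1) (hre : κ * ε ^ 2 ≤ (1 - z).re) (hz : ‖1 - z‖ ≤ 8 * κ * ε) :
    ‖blockPreimage q q' z‖ ≤ 1 - μ * κ / 2 * ε ^ 2 := by
  have hp : 0 < 1 - (q : ℝ) := sub_pos.2 hq
  have hp' : 0 < 1 - (q' : ℝ) := sub_pos.2 hq'
  have hμ0 : 0 < μ := by rw [hμ]; positivity
  have hκ0 : 0 < κ := by rw [hκ]; positivity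
  have hκμ : κ * (1 + μ) = 1 / 256 := by rw [hκ]; field_simp
  have hκ1 : κ ≤ 1 / 256 := by nlinarith
  have hκε : κ * ε ≤ 1 / 256 := by nlinarith
  have hz2 : ‖1 - z‖ ≤ 1 / 2 := by linarith
  have hden := one_half_le_norm_one_sub_mul q' hz2
  set δ : ℂ := 1 - z with hδ
  set E : ℂ := 1 - ((q' : ℝ) : ℂ) * δ with hE
  have hE0 : E ≠ 0 := norm_pos_iff.1 (by linarith)
  have hsq : ‖δ‖ ^ 2 ≤ 64 * κ ^ 2 * ε ^ 2 := by
    calc ‖δ‖ ^ 2 ≤ (8 * κ * ε) ^ 2 := by gcongr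
      _ = _ := by ring
  have hrest : ‖((q' : ℝ) : ℂ) * δ ^ 2 / E‖ ≤ 2 * ‖δ‖ ^ 2 := by
    rw [norm_div, norm_mul, norm_pow, Complex.norm_real, Real.norm_of_nonneg q'.2.1,
      div_le_iff₀ (by linarith)]
    nlinarith [q'.2.2, q'.2.1, sq_nonneg ‖δ‖, mul_nonneg (sq_nonneg ‖δ‖) (sub_nonneg.2 hden),
      mul_le_mul_of_nonneg_right q'.2.2 (sq_nonneg ‖δ‖)]
  have hquot : δ / E = δ + ((q' : ℝ) : ℂ) * δ ^ 2 / E := by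
    field_simp
    rw [hE]; ring
  have hqre : κ * ε ^ 2 - 2 * ‖δ‖ ^ 2 ≤ (δ / E).re := by
    rw [hquot, Complex.add_re]
    have := (Complex.abs_re_le_norm (((q' : ℝ) : ℂ) * δ ^ 2 / E)).trans hrest
    have := (abs_le.1 this).1
    linarith
  have hqn : ‖δ / E‖ ≤ 2 * ‖δ‖ := by
    rw [norm_div, div_le_iff₀ (by linarith)]
    nlinarith [norm_nonneg δ]
  have hw : blockPreimage q q' z = 1 - (μ : ℂ) * (δ / E) := by
    rw [blockPreimage, hμ]; push_cast; rfl
  have hwn : ‖blockPreimage q q' z‖ ^ 2 = 1 - 2 * μ * (δ / E).re + μ ^ 2 * ‖δ / E‖ ^ 2 := by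
    rw [hw, ← Complex.normSq_eq_norm_sq, ← Complex.normSq_eq_norm_sq, Complex.normSq_apply,
      Complex.normSq_apply]
    simp
    ring
  have hqn2 : ‖δ / E‖ ^ 2 ≤ 4 * ‖δ‖ ^ 2 := by
    calc ‖δ / E‖ ^ 2 ≤ (2 * ‖δ‖) ^ 2 := by gcongr
      _ = _ := by ring
  have hfin : ‖blockPreimage q q' z‖ ^ 2 ≤ 1 - μ * κ * ε ^ 2 := by
    rw [hwn]
    have e1 : 2 * μ * (κ * ε ^ 2 - 2 * ‖δ‖ ^ 2) ≤ 2 * μ * (δ / E).re := by gcongr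
    have e2 : μ ^ 2 * ‖δ / E‖ ^ 2 ≤ μ ^ 2 * (4 * ‖δ‖ ^ 2) := by gcongr
    have e3 : (4 * μ + 4 * μ ^ 2) * ‖δ‖ ^ 2 ≤ (4 * μ + 4 * μ ^ 2) * (64 * κ ^ 2 * ε ^ 2) := by gcongr
    have e4 : (4 * μ + 4 * μ ^ 2) * (64 * κ ^ 2 * ε ^ 2) = μ * κ * ε ^ 2 := by
      linear_combination 256 * μ * κ * ε ^ 2 * hκμ
    linarith
  have hsmall : μ * κ * ε ^ 2 ≤ 1 := by
    have : μ * κ ≤ 1 := by nlinarith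
    have : ε ^ 2 ≤ 1 := by nlinarith
    calc μ * κ * ε ^ 2 ≤ 1 * 1 := by gcongr
      _ = 1 := one_mul 1
  refine le_of_sq_le_sq (hfin.trans ?_) (by linarith)
  nlinarith [sq_nonneg (μ * κ * ε ^ 2)]

/-! ### Averages of powers of `z` -/

lemma norm_pow_sub_pow_le {z : ℂ} (hz : ‖z‖ ≤ 1) (a b : ℕ) :
    ‖z ^ a - z ^ b‖ ≤ |(a : ℝ) - b| * ‖1 - z‖ := by
  wlog h : a ≤ b generalizing a b
  · rw [norm_sub_rev, abs_sub_comm]; exact this b a (by omega)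
  obtain ⟨n, rfl⟩ := Nat.exists_eq_add_of_le h
  have h1 : ‖1 - z ^ n‖ ≤ n * ‖1 - z‖ := by
    rw [← mul_neg_geom_sum, norm_mul, mul_comm]
    refine mul_le_mul_of_nonneg_right ?_ (norm_nonneg _)
    refine (norm_sum_le _ _).trans ((Finset.sum_le_card_nsmul _ _ 1 fun i _ => ?_).trans_eq ?_)
    · rw [norm_pow]; exact pow_le_one₀ (norm_nonneg z) hz
    · simp
  rw [pow_add, show z ^ a - z ^ a * z ^ n = z ^ a * (1 - z ^ n) by ring, norm_mul, norm_pow]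
  push_cast
  rw [show (a : ℝ) - (a + n) = -n by ring, abs_neg, Nat.abs_cast]
  exact (mul_le_of_le_one_left (norm_nonneg _) (pow_le_one₀ (norm_nonneg z) hz)).trans h1

lemma sum_toReal_pmf {d : ℕ} (σ : PMF (Fin (d + 1))) : ∑ s, (σ s).toReal = 1 := by
  have h := σ.tsum_coe
  rw [tsum_fintype] at h
  rw [← ENNReal.toReal_sum fun s _ => σ.apply_ne_top s, h, ENNReal.toReal_one]

/-- If `σ` is concentrated around its mean and `z` is close to `1`, there is little cancellation in
the average of the powers of `z`. -/
lemma one_fourth_le_norm_sum_pmf_mul_pow {d : ℕ} (σ : PMF (Fin (d + 1))) {M η : ℝ} (hM : 1 ≤ M)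
    (hσ : meanAbsDev σ ≤ M) {z : ℂ} (hz : ‖z‖ ≤ 1) (hzd : 1 / 2 ≤ ‖z‖ ^ d) (hzη : ‖1 - z‖ ≤ η)
    (hη : M * η ≤ 1 / 8) :
    1 / 4 ≤ ‖∑ s, ((σ s).toReal : ℂ) * z ^ (d - (s : ℕ))‖ := by
  have hmean0 : 0 ≤ pmfMean σ := Finset.sum_nonneg fun s _ => by positivity
  have hmean : pmfMean σ ≤ d := by
    calc pmfMean σ ≤ ∑ s, (σ s).toReal * (d : ℝ) := by
          refine Finset.sum_le_sum fun s _ => ?_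
          have : (s : ℝ) ≤ d := by exact_mod_cast Nat.lt_succ_iff.1 s.2
          gcongr
      _ = d := by rw [← Finset.sum_mul, sum_toReal_pmf, one_mul]
  -- The mean is rounded to get a natural exponent; the extra deviation of at most `1` is absorbed
  -- by `1 ≤ M`.
  set t := ⌊pmfMean σ⌋₊ with ht
  have htd : t ≤ d := Nat.floor_le_of_le hmean
  have ht1 := Nat.floor_le hmean0
  have ht2 := Nat.lt_floor_add_one (pmfMean σ)
  rw [← ht] at ht1 ht2
  have hdev : ∑ s, (σ s).toReal * |(s : ℝ) - t| ≤ 2 * M := by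
    calc ∑ s, (σ s).toReal * |(s : ℝ) - t|
        ≤ ∑ s, ((σ s).toReal * |(s : ℝ) - pmfMean σ| + (σ s).toReal * 1) := by
          refine Finset.sum_le_sum fun s _ => ?_
          rw [← mul_add]
          refine mul_le_mul_of_nonneg_left ?_ ENNReal.toReal_nonneg
          have h1 := abs_sub_le (s : ℝ) (pmfMean σ) t
          have h2 : |pmfMean σ - t| ≤ 1 := abs_le.2 ⟨by linarith, by linarith⟩
          linarith
      _ = meanAbsDev σ + 1 := by
          rw [Finset.sum_add_distrib, ← Finset.sum_mul, sum_toReal_pmf, one_mul]; rfl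
      _ ≤ 2 * M := by linarith
  have hdiff : ‖∑ s, ((σ s).toReal : ℂ) * z ^ (d - (s : ℕ)) - z ^ (d - t)‖ ≤ 2 * M * η := by
    have h1 : z ^ (d - t) = ∑ s, ((σ s).toReal : ℂ) * z ^ (d - t) := by
      rw [← Finset.sum_mul, ← Complex.ofReal_sum, sum_toReal_pmf, Complex.ofReal_one, one_mul]
    rw [h1, ← Finset.sum_sub_distrib]
    calc _ ≤ ∑ s, (σ s).toReal * |(s : ℝ) - t| * η := by
          refine norm_sum_le_of_le _ fun s _ => ?_
          rw [← mul_sub, norm_mul, Complex.norm_real, Real.norm_of_nonneg ENNReal.toReal_nonneg,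
            mul_assoc]
          refine mul_le_mul_of_nonneg_left ?_ ENNReal.toReal_nonneg
          refine (norm_pow_sub_pow_le hz _ _).trans ?_
          have hs : (s : ℕ) ≤ d := Nat.lt_succ_iff.1 s.2
          rw [Nat.cast_sub hs, Nat.cast_sub htd, abs_sub_comm,
            show (d : ℝ) - t - (d - (s : ℕ)) = (s : ℕ) - t by ring]
          gcongr
      _ ≤ 2 * M * η := by
          rw [← Finset.sum_mul]
          exact mul_le_mul_of_nonneg_right hdev ((norm_nonneg _).trans hzη)
  have hlow : 1 / 2 ≤ ‖z ^ (d - t)‖ := by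
    rw [norm_pow]
    exact hzd.trans (pow_le_pow_of_le_one (norm_nonneg z) hz (Nat.sub_le d t))
  have := norm_sub_norm_le (z ^ (d - t)) (∑ s, ((σ s).toReal : ℂ) * z ^ (d - (s : ℕ)))
  rw [norm_sub_rev] at this
  linarith

/-! ### The generating function of the averaged difference -/

/-- The difference of the averaged trace bit probabilities of two strings. -/
def avgDiff (q q' : unitInterval) {d : ℕ} (σ : PMF (Fin (d + 1))) (x y : ℕ → Bool) (j : ℕ) : ℝ :=
  shiftedTraceBitProb q q' σ x j - shiftedTraceBitProb q q' σ y j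

lemma avgDiff_eq_sum (q q' : unitInterval) {d : ℕ} (σ : PMF (Fin (d + 1))) (x y : ℕ → Bool)
    (j : ℕ) : avgDiff q q' σ x y j = ∑ s, (σ s).toReal *
      (traceBitProb q q' (shift s x) j - traceBitProb q q' (shift s y) j) := by
  simp only [avgDiff, shiftedTraceBitProb, mul_sub, Finset.sum_sub_distrib]

lemma abs_avgDiff_le (q q' : unitInterval) {d : ℕ} (σ : PMF (Fin (d + 1))) (x y : ℕ → Bool)
    (j : ℕ) : |avgDiff q q' σ x y j| ≤ 1 := by
  have h : ∀ z : ℕ → Bool, 0 ≤ traceBitProb q q' z j ∧ traceBitProb q q' z j ≤ 1 :=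
    fun z => ⟨measureReal_nonneg, measureReal_le_one⟩
  rw [avgDiff_eq_sum, ← sum_toReal_pmf σ]
  rw [← Real.norm_eq_abs]
  refine norm_sum_le_of_le _ fun s _ => ?_
  rw [Real.norm_eq_abs, abs_mul, abs_of_nonneg ENNReal.toReal_nonneg]
  refine mul_le_of_le_one_right ENNReal.toReal_nonneg (abs_le.2 ⟨?_, ?_⟩) <;>
  linarith [(h (shift s x)).1, (h (shift s x)).2, (h (shift s y)).1, (h (shift s y)).2]

lemma pow_mul_tsum_avgDiff {q q' : unitInterval} (hq : q < 1) (hq' : q' < 1) {d : ℕ}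
    (σ : PMF (Fin (d + 1))) {x y : ℕ → Bool} (hxy : ∀ i ≤ d, x i = y i) {z : ℂ}
    (hz1 : ‖z‖ < 1) (hz : ‖1 - z‖ ≤ 1 / 2) (hw : ‖blockPreimage q q' z‖ < 1) :
    z ^ d * ∑' j, blockPreimage q q' z ^ j * (avgDiff q q' σ x y j : ℂ) =
      (1 - (q : ℝ) : ℝ) * (1 - (q' : ℝ) * (1 - z)) *
        (∑ s, ((σ s).toReal : ℂ) * z ^ (d - (s : ℕ))) * realPowerSeries (bitDiff x y) z := by
  set w := blockPreimage q q' z with hwdef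
  have hp' : ((1 - (q' : ℝ) : ℝ) : ℂ) ≠ 0 := by
    have : (q' : ℝ) < 1 := hq'
    exact_mod_cast (sub_pos.2 this).ne'
  have hs : ∀ s : Fin (d + 1), HasSum
      (fun j => ((σ s).toReal : ℂ) * (w ^ j *
        ((traceBitProb q q' (shift s x) j - traceBitProb q q' (shift s y) j : ℝ) : ℂ)))
      ((σ s).toReal * ((1 - (q : ℝ) : ℝ) * (1 - (q' : ℝ) * (1 - z)) *
        realPowerSeries (fun k => bitDiff x y (s + k)) z)) := by
    intro s
    have h := (hasSum_pow_mul_traceBitProb_sub hq hq' hw (shift s x) (shift s y)).mul_left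
      ((σ s).toReal : ℂ)
    rw [hwdef, blockPGF_affine_blockPreimage hq hq' hz,
      one_sub_mul_affine_blockPreimage q' hq hz, div_div_cancel₀ hp'] at h
    exact h
  have hsum := hasSum_sum fun s (_ : s ∈ Finset.univ) => hs s
  have hF : ∑' j, w ^ j * (avgDiff q q' σ x y j : ℂ) =
      ∑ s : Fin (d + 1), ((σ s).toReal : ℂ) * ((1 - (q : ℝ) : ℝ) * (1 - (q' : ℝ) * (1 - z)) *
        realPowerSeries (fun k => bitDiff x y (s + k)) z) := by
    rw [← hsum.tsum_eq]
    refine tsum_congr fun j => ?_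
    rw [avgDiff_eq_sum, Complex.ofReal_sum, Finset.mul_sum]
    refine Finset.sum_congr rfl fun s _ => ?_
    push_cast
    ring
  rw [hF, Finset.mul_sum, Finset.mul_sum, Finset.sum_mul]
  refine Finset.sum_congr rfl fun s _ => ?_
  have hsd : (s : ℕ) ≤ d := Nat.lt_succ_iff.1 s.2
  -- Agreement up to `d ≥ s` lets `z ^ s` factor out of the unshifted series; the prefactor `z ^ d`
  -- keeps all exponents `d - s` nonnegative.
  rw [realPowerSeries_eq_pow_mul (abs_bitDiff_le x y) (n := s)
    (fun k hk => bitDiff_eq_zero (hxy k (by omega))) hz1]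
  nth_rewrite 1 [← Nat.sub_add_cancel hsd]
  rw [pow_add]
  ring

/-! ### From the generating function to a coefficient -/

lemma norm_tsum_pow_mul_le {Δ : ℕ → ℝ} (hΔ : ∀ j, |Δ j| ≤ 1) {w : ℂ} (hw : ‖w‖ < 1) (J : ℕ) :
    ‖∑' j, w ^ j * (Δ j : ℂ)‖ ≤ ∑ j ∈ Finset.range J, |Δ j| + ‖w‖ ^ J / (1 - ‖w‖) := by
  have h : ∑' j, w ^ j * (Δ j : ℂ) = realPowerSeries Δ w := tsum_congr fun j => mul_comm _ _
  have hs := summable_realPowerSeries hΔ hw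
  rw [h, realPowerSeries, ← hs.sum_add_tsum_nat_add J]
  refine (norm_add_le _ _).trans (add_le_add ?_ ?_)
  · refine norm_sum_le_of_le _ fun j _ => ?_
    rw [norm_mul, norm_pow, Complex.norm_real, Real.norm_eq_abs]
    exact mul_le_of_le_one_right (abs_nonneg _) (pow_le_one₀ (norm_nonneg w) hw.le)
  · refine tsum_of_norm_bounded (g := fun k => ‖w‖ ^ J * ‖w‖ ^ k) ?_ fun k => ?_
    · rw [div_eq_mul_inv]
      exact (hasSum_geometric_of_lt_one (norm_nonneg w) hw).mul_left _
    · refine (norm_realPowerSeries_term_le hΔ _ w).trans_eq ?_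
      rw [pow_add, mul_comm]

lemma le_exp_mul {a M : ℝ} (ha : 0 ≤ a) (hM : 1 ≤ M) : a ≤ Real.exp (a * M) := by
  have := Real.add_one_le_exp (a * M)
  nlinarith

lemma pow_le_exp_mul {M : ℝ} (hM : 0 ≤ M) (n : ℕ) : M ^ n ≤ Real.exp (n * M) := by
  rw [Real.exp_nat_mul]
  exact pow_le_pow_left₀ hM (by linarith [Real.add_one_le_exp M]) n

/-- If a power series with coefficients bounded by `1` is not too small at a point that is not too
close to the unit circle, then one of its first coefficients is not too small. -/
lemma exists_large_coeff {a b c : ℝ} (ha : 0 < a) (hb : 0 ≤ b) (hc : 0 < c) :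
    ∃ Csep Cfwd : ℝ, 0 < Csep ∧ 0 < Cfwd ∧ ∀ (m : ℕ) (M : ℝ), 1 ≤ M → M ^ 3 = m →
      ∀ Δ : ℕ → ℝ, (∀ j, |Δ j| ≤ 1) → ∀ w : ℂ, ‖w‖ ≤ 1 - c / M ^ 2 →
      a * Real.exp (-b * M) ≤ ‖∑' j, w ^ j * (Δ j : ℂ)‖ →
      ∃ j : ℕ, (j : ℝ) < Cfwd * m ∧ Real.exp (-Csep * M) ≤ |Δ j| := by
  -- The summands of `c * C` pay for `exp (-b * M)`, for the constant `2 / (a * c)` and for `M ^ 2`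
  -- in the tail bound, making the tail at most half of the lower bound.
  set C : ℝ := (b + 2 / (a * c) + 2) / c with hC
  have hC0 : 0 < C := by positivity
  -- Beyond `b`, the first constant pays for pigeonholing over at most `(C + 1) * M ^ 3`
  -- coefficients.
  refine ⟨b + 2 / a * (C + 1) + 3, C, by positivity, hC0, ?_⟩
  intro m M hM hMm Δ hΔ w hw hlow
  have hM0 : 0 < M := by linarith
  have hcM : 0 < c / M ^ 2 := by positivity
  have hw1 : ‖w‖ < 1 := by linarith
  set J := ⌈C * m⌉₊ with hJ
  have hJ1 : C * m ≤ J := Nat.le_ceil _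
  have hJ2 : (J : ℝ) < C * m + 1 := Nat.ceil_lt_add_one (by positivity)
  have hm1 : (1 : ℝ) ≤ m := by rw [← hMm]; exact one_le_pow₀ hM
  have hpow : ‖w‖ ^ J ≤ Real.exp (-(c * C) * M) := by
    calc ‖w‖ ^ J ≤ Real.exp (-(c / M ^ 2)) ^ J := by
          refine pow_le_pow_left₀ (norm_nonneg w) (hw.trans ?_) J
          linarith [Real.add_one_le_exp (-(c / M ^ 2))]
      _ = Real.exp (J * -(c / M ^ 2)) := (Real.exp_nat_mul _ _).symm
      _ ≤ _ := by
          refine Real.exp_le_exp.2 ?_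
          have : (C * M ^ 3) * (c / M ^ 2) ≤ J * (c / M ^ 2) := by rw [hMm]; gcongr
          have h2 : (C * M ^ 3) * (c / M ^ 2) = c * C * M := by field_simp
          linarith
  have htail : ‖w‖ ^ J / (1 - ‖w‖) ≤ a / 2 * Real.exp (-b * M) := by
    calc ‖w‖ ^ J / (1 - ‖w‖) ≤ Real.exp (-(c * C) * M) / (c / M ^ 2) := by
          gcongr; linarith
      _ = a / 2 * (2 / (a * c) * M ^ 2 * Real.exp (-(c * C) * M)) := by field_simp
      _ ≤ a / 2 * (Real.exp (2 / (a * c) * M) * Real.exp ((2 : ℕ) * M) *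
            Real.exp (-(c * C) * M)) := by
          gcongr
          · exact le_exp_mul (by positivity) hM
          · exact pow_le_exp_mul hM0.le 2
      _ = a / 2 * Real.exp (-b * M) := by
          rw [← Real.exp_add, ← Real.exp_add]
          congr 2
          have : c * C = b + 2 / (a * c) + 2 := by rw [hC]; field_simp
          rw [this]; push_cast; ring
  have hsum : a / 2 * Real.exp (-b * M) ≤ ∑ j ∈ Finset.range J, |Δ j| := by
    have := norm_tsum_pow_mul_le hΔ hw1 J
    linarith
  by_contra! hcon
  have hne : (Finset.range J).Nonempty := by
    refine Finset.nonempty_range_iff.2 fun h => ?_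
    rw [h] at hJ1
    have : 0 < C * m := by positivity
    simp at hJ1; linarith
  have hstrict : ∑ j ∈ Finset.range J, |Δ j| <
      J * Real.exp (-(b + 2 / a * (C + 1) + 3) * M) := by
    have := Finset.sum_lt_sum_of_nonempty hne fun j hj =>
      hcon j (Nat.lt_ceil.1 (Finset.mem_range.1 hj))
    simpa using this
  have hJle : (J : ℝ) ≤ a / 2 * Real.exp ((2 / a * (C + 1) + 3) * M) := by
    calc (J : ℝ) ≤ (C + 1) * M ^ 3 := by rw [hMm]; linarith
      _ = a / 2 * (2 / a * (C + 1) * M ^ 3) := by field_simp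
      _ ≤ a / 2 * (Real.exp (2 / a * (C + 1) * M) * Real.exp ((3 : ℕ) * M)) := by
          gcongr
          · exact le_exp_mul (by positivity) hM
          · exact pow_le_exp_mul hM0.le 3
      _ = _ := by rw [← Real.exp_add]; congr 2; push_cast; ring
  have hfinal : J * Real.exp (-(b + 2 / a * (C + 1) + 3) * M) ≤ a / 2 * Real.exp (-b * M) := by
    calc _ ≤ a / 2 * Real.exp ((2 / a * (C + 1) + 3) * M) *
          Real.exp (-(b + 2 / a * (C + 1) + 3) * M) := by gcongr
      _ = _ := by rw [mul_assoc, ← Real.exp_add]; congr 2; ring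
  linarith

/-- The generating function of the averaged difference is not too small at some point that is not
too close to the unit circle. -/
lemma exists_large_value {q q' : unitInterval} (hq : q < 1) (hq' : q' < 1) :
    ∃ a b c : ℝ, 0 < a ∧ 0 ≤ b ∧ 0 < c ∧ ∀ (d m : ℕ) (M : ℝ), 1 ≤ M → M ^ 3 = m →
      (d : ℝ) ≤ M ^ 2 → ∀ x y : ℕ → Bool, (∀ i ≤ d, x i = y i) → (∃ i ≤ m, x i ≠ y i) →
      ∀ σ : PMF (Fin (d + 1)), meanAbsDev σ ≤ M →
      ∃ w : ℂ, ‖w‖ ≤ 1 - c / M ^ 2 ∧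
        a * Real.exp (-b * M) ≤ ‖∑' j, w ^ j * (avgDiff q q' σ x y j : ℂ)‖ := by
  have hp : 0 < 1 - (q : ℝ) := sub_pos.2 hq
  have hp' : 0 < 1 - (q' : ℝ) := sub_pos.2 hq'
  obtain ⟨μ, hμ⟩ : ∃ μ, μ = (1 - (q' : ℝ)) / (1 - (q : ℝ)) := ⟨_, rfl⟩
  obtain ⟨κ, hκ⟩ : ∃ κ, κ = 1 / (256 * (1 + μ)) := ⟨_, rfl⟩
  have hμ0 : 0 < μ := by rw [hμ]; positivity
  have hκ0 : 0 < κ := by rw [hκ]; positivity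
  have hκ1 : κ ≤ 1 / 256 := by
    rw [hκ]
    exact one_div_le_one_div_of_le (by norm_num) (by linarith)
  -- `32 = 2 * 4 * 4`: the Möbius denominator, the average over `σ`, and the factor `4` of the arc
  -- estimate. The exponent collects `‖z‖ ^ l` and `(1 / 8) ^ N`.
  refine ⟨(1 - (q : ℝ)) / 32, 20 * κ + 3 * (1 / κ + 1), μ * κ / 2, by positivity, by positivity,
    by positivity, ?_⟩
  intro d m M hM hMm hdM x y hxy hne σ hσ
  have hM0 : 0 < M := by linarith
  -- This scale balances the two losses: `m * ε ^ 2` and `1 / ε` are both `M`.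
  obtain ⟨ε, hε⟩ : ∃ ε, ε = 1 / M := ⟨_, rfl⟩
  have hε0 : 0 < ε := by rw [hε]; positivity
  have hε1 : ε ≤ 1 := by rw [hε]; exact div_le_one_of_le₀ hM hM0.le
  have hMε : M * ε = 1 := by rw [hε]; field_simp
  have hdε : d * ε ^ 2 ≤ 1 := by
    calc d * ε ^ 2 ≤ M ^ 2 * ε ^ 2 := by gcongr
      _ = 1 := by rw [← mul_pow, hMε, one_pow]
  have hmε : m * ε ^ 2 = M := by
    rw [← hMm]; linear_combination (M * (M * ε) + M) * hMε
  have hκε : κ * ε ^ 2 ≤ κ := mul_le_of_le_one_right hκ0.le (pow_le_one₀ hε0.le hε1)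
  have hκε0 : 0 < κ * ε ^ 2 := by positivity
  classical
  obtain ⟨l, ⟨hlm, hl⟩, hlmin⟩ : ∃ l, (l ≤ m ∧ x l ≠ y l) ∧ ∀ k < l, x k = y k := by
    refine ⟨Nat.find hne, Nat.find_spec hne, fun k hk => ?_⟩
    by_contra h
    exact Nat.find_min hne hk ⟨hk.le.trans (Nat.find_spec hne).1, h⟩
  -- Large enough that `π / N ≤ 4 * κ * ε`, yet of order `M`.
  set N := ⌈1 / (κ * ε)⌉₊ with hN
  have hN0 : 0 < N := Nat.ceil_pos.2 (by positivity)
  have hN1 : 1 / (κ * ε) ≤ N := Nat.le_ceil _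
  have hN2 : (N : ℝ) ≤ (1 / κ + 1) * M := by
    have h1 : (N : ℝ) < 1 / (κ * ε) + 1 := Nat.ceil_lt_add_one (by positivity)
    have h2 : 1 / (κ * ε) = 1 / κ * M := by rw [hε]; field_simp
    rw [h2] at h1
    linarith
  obtain ⟨τ, hτ, hlow⟩ := exists_le_norm_realPowerSeries_on_arc
    (c := fun k => bitDiff x y (l + k)) (fun k => abs_bitDiff_le x y _) (abs_bitDiff_eq_one hl)
    hN0 (r := 1 - κ * ε ^ 2) (by linarith) (by linarith)
  have hτ' : |τ| ≤ 4 * κ * ε := by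
    refine hτ.trans ?_
    rw [div_le_iff₀ (by exact_mod_cast hN0)]
    rw [div_le_iff₀ (by positivity)] at hN1
    have hπ := Real.pi_lt_four
    nlinarith
  obtain ⟨z, hz⟩ : ∃ z, z = discMap (((1 - κ * ε ^ 2 : ℝ) : ℂ) * Complex.exp (τ * Complex.I)) :=
    ⟨_, rfl⟩
  rw [← hz] at hlow
  obtain ⟨hre, hzn, hzlow, hz1⟩ := arc_geometry hκ0 hκ1 hε0 hε1 hτ' hz
  have hw := norm_blockPreimage_le hq hq' hμ hκ hε0 hε1 hre hzn
  have hκε' : κ * ε ≤ κ := mul_le_of_le_one_right hκ0.le hε1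
  have hzhalf : ‖1 - z‖ ≤ 1 / 2 := by linarith
  have hcε : 0 < μ * κ / 2 * ε ^ 2 := by positivity
  refine ⟨blockPreimage q q' z, ?_, ?_⟩
  · rwa [div_eq_mul_one_div, ← one_div_pow, ← hε]
  have hid := congrArg norm (pow_mul_tsum_avgDiff hq hq' σ hxy hz1 hzhalf (by linarith))
  rw [norm_mul, norm_pow] at hid
  -- Bernoulli's inequality; the bound on `d` enters here through `d * ε ^ 2 ≤ 1`.
  have hzd : 1 / 2 ≤ ‖z‖ ^ d := by
    have h1 := one_add_mul_le_pow (a := -(10 * κ * ε ^ 2)) (by linarith) d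
    have h2 : (1 + -(10 * κ * ε ^ 2)) ^ d ≤ ‖z‖ ^ d :=
      pow_le_pow_left₀ (by linarith) (by linarith) d
    nlinarith
  have hzl : Real.exp (-(20 * κ) * M) ≤ ‖z‖ ^ l := by
    have h1 : Real.exp (-(20 * κ * ε ^ 2)) ≤ ‖z‖ := by
      refine le_trans ?_ hzlow
      rw [Real.exp_neg]
      refine inv_le_of_inv_le₀ (by linarith) ?_
      refine le_trans ?_ (Real.add_one_le_exp _)
      rw [inv_le_iff_one_le_mul₀ (by linarith)]
      nlinarith
    calc Real.exp (-(20 * κ) * M) = Real.exp (-(20 * κ * ε ^ 2)) ^ m := by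
          rw [← Real.exp_nat_mul]
          congr 1
          linear_combination (20 * κ) * hmε
      _ ≤ ‖z‖ ^ m := pow_le_pow_left₀ (Real.exp_pos _).le h1 m
      _ ≤ ‖z‖ ^ l := pow_le_pow_of_le_one (norm_nonneg z) hz1.le hlm
  have h8 : Real.exp (-(3 * (1 / κ + 1)) * M) ≤ (1 / 8 : ℝ) ^ N := by
    have h1 : Real.exp (-3) ≤ 1 / 8 := by
      rw [Real.exp_neg, one_div]
      refine inv_anti₀ (by norm_num) ?_
      have : Real.exp 3 = Real.exp 1 ^ 3 := by rw [← Real.exp_nat_mul]; norm_num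
      rw [this]
      calc (8 : ℝ) = 2 ^ 3 := by norm_num
        _ ≤ _ := pow_le_pow_left₀ (by norm_num) (by linarith [Real.add_one_le_exp 1]) 3
    calc Real.exp (-(3 * (1 / κ + 1)) * M) ≤ Real.exp (N * -3) := Real.exp_le_exp.2 (by linarith)
      _ = Real.exp (-3) ^ N := Real.exp_nat_mul _ _
      _ ≤ _ := pow_le_pow_left₀ (Real.exp_pos _).le h1 N
  have hQ := one_fourth_le_norm_sum_pmf_mul_pow σ hM hσ hz1.le hzd hzn (by
    calc M * (8 * κ * ε) = 8 * κ * (M * ε) := by ring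
      _ ≤ 1 / 8 := by rw [hMε]; linarith)
  have hA : Real.exp (-(20 * κ) * M) * (Real.exp (-(3 * (1 / κ + 1)) * M) / 4) ≤
      ‖realPowerSeries (bitDiff x y) z‖ := by
    rw [realPowerSeries_eq_pow_mul (abs_bitDiff_le x y)
      (fun k hk => bitDiff_eq_zero (hlmin k hk)) hz1, norm_mul, norm_pow]
    refine mul_le_mul hzl ?_ (by positivity) (by positivity)
    linarith
  have hden := one_half_le_norm_one_sub_mul q' hzhalf
  calc (1 - (q : ℝ)) / 32 * Real.exp (-(20 * κ + 3 * (1 / κ + 1)) * M)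
      = (1 - (q : ℝ)) * (1 / 2) * (1 / 4) *
        (Real.exp (-(20 * κ) * M) * (Real.exp (-(3 * (1 / κ + 1)) * M) / 4)) := by
        rw [show -(20 * κ + 3 * (1 / κ + 1)) * M =
          -(20 * κ) * M + -(3 * (1 / κ + 1)) * M by ring, Real.exp_add]
        ring
    _ ≤ (1 - (q : ℝ)) * ‖1 - ((q' : ℝ) : ℂ) * (1 - z)‖ *
        ‖∑ s, ((σ s).toReal : ℂ) * z ^ (d - (s : ℕ))‖ * ‖realPowerSeries (bitDiff x y) z‖ := by
        gcongr
    _ = ‖z‖ ^ d * ‖∑' j, blockPreimage q q' z ^ j * (avgDiff q q' σ x y j : ℂ)‖ := by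
        rw [hid, norm_mul, norm_mul, norm_mul, Complex.norm_real, Real.norm_of_nonneg hp.le]
    _ ≤ _ := mul_le_of_le_one_left (norm_nonneg _) (pow_le_one₀ (norm_nonneg z) hz1.le)

end

theorem theorem1p3 (q q' : unitInterval) (hq : q < 1) (hq' : q' < 1) :
    ∃ Csep Cfwd : ℝ, 0 < Csep ∧ 0 < Cfwd ∧
      ∀ (d m : ℕ), (d : ℝ) ≤ (m : ℝ) ^ (2 / 3 : ℝ) →
      ∀ (x₁ x₂ : ℕ → Bool), (∀ i ≤ d, x₁ i = x₂ i) → (∃ i ≤ m, x₁ i ≠ x₂ i) →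
      ∀ (σ : PMF (Fin (d + 1))), meanAbsDev σ ≤ (m : ℝ) ^ (1 / 3 : ℝ) →
      ∃ j : ℕ, (j : ℝ) < Cfwd * m ∧
        Real.exp (-Csep * (m : ℝ) ^ (1 / 3 : ℝ)) ≤
          |shiftedTraceBitProb q q' σ x₁ j - shiftedTraceBitProb q q' σ x₂ j| := by
  obtain ⟨a, b, c, ha, hb, hc, hvalue⟩ := exists_large_value hq hq'
  obtain ⟨Csep, Cfwd, hsep, hfwd, hcoeff⟩ := exists_large_coeff ha hb hc
  refine ⟨Csep, Cfwd, hsep, hfwd, fun d m hd x₁ x₂ hx hne σ hσ => ?_⟩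
  have hm : 1 ≤ m := by
    obtain ⟨i, hi, h⟩ := hne
    by_contra! h0
    exact h (hx i (by omega))
  have hM : 1 ≤ (m : ℝ) ^ (1 / 3 : ℝ) :=
    Real.one_le_rpow (by exact_mod_cast hm) (by norm_num)
  have hM3 : ((m : ℝ) ^ (1 / 3 : ℝ)) ^ 3 = m := by
    rw [← Real.rpow_mul_natCast (Nat.cast_nonneg m)]; norm_num
  have hM2 : ((m : ℝ) ^ (1 / 3 : ℝ)) ^ 2 = (m : ℝ) ^ (2 / 3 : ℝ) := by
    rw [← Real.rpow_mul_natCast (Nat.cast_nonneg m)]; norm_num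
  obtain ⟨w, hw, hlow⟩ := hvalue d m _ hM hM3 (hM2 ▸ hd) x₁ x₂ hx hne σ hσ
  exact hcoeff m _ hM hM3 _ (abs_avgDiff_le q q' σ x₁ x₂) w hw hlow
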